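/- Let $0<a<1$, let $H$ be a separable complex Hilbert space and let $T\in L(H)$. Write $(1-t)^a=\sum_{n\ge0}\alpha_nt^n$ and $(1-t)^{-a}=\sum_{n\ge0}k_nt^n$ for $|t|<1$ (so $k_n>0$ for all $n$). The operator $T$ is called an $a$-contraction if the series $\sum_{n\ge0}\alpha_nT^{*n}T^n$ converges in the strong operator topology and its sum, denoted $(1-t)^a(T^*,T)$, is a non-negative operator. In that case let $D:=\big((1-t)^a(T^*,T)\big)^{1/2}$ and let $\mathfrak D:=\overline{DH}$ be the defect space. Let $\mathcal H_a$ be the Hilbert space of power series $f(t)=\sum_{n\ge0}f_nt^n$ with complex coefficients and norm $\|f\|^2=\sum_{n\ge0}|f_n|^2k_n<\infty$, and let $B_a$ be the (bounded) backward shift on $\mathcal H_a$, $B_af(t)=\frac{f(t)-f(0)}{t}$. A part of an operator is its restriction to a closed invariant subspace. The following statements are equivalent. (i) $T$ is an $a$-contraction. (ii) There exist a separable Hilbert space $\mathcal E$ and an isometry $S$ on some Hilbert space such that $T$ is unitarily equivalent to a part of $(B_a\otimes I_{\mathcal E})\oplus S$. Moreover, if (ii) holds, then one can take $\mathcal E=\mathfrak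 D$; that is, there is an isometry $S$ on some Hilbert space such that $T$ is unitarily equivalent to a part of $(B_a\otimes I_{\mathfrak D})\oplus S$. -/

import Mathlib

open Filter Topology
open scoped TensorProduct

universe u

/-! ### Taylor coefficients of `(1 - t) ^ (-s)` -/

/-- The Cesàro number `k^s(n) = s (s + 1) ⋯ (s + n - 1) / n!`, that is, the `n`-th Taylor
coefficient at the origin of `(1 - t) ^ (-s)`; see `hasSum_cesaroNumber`. -/
noncomputable def cesaroNumber (s : ℝ) (n : ℕ) : ℝ :=
  (∏ i ∈ Finset.range n, (s + i)) / (n.factorial : ℝ)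

theorem cesaroNumber_succ (s : ℝ) (n : ℕ) :
    ((n : ℝ) + 1) * cesaroNumber s (n + 1) = (s + n) * cesaroNumber s n := by
  have h1 : (n.factorial : ℝ) ≠ 0 := by exact_mod_cast n.factorial_ne_zero
  have h2 : (n : ℝ) + 1 ≠ 0 := by positivity
  simp only [cesaroNumber, Finset.prod_range_succ, Nat.factorial_succ, Nat.cast_mul,
    Nat.cast_add, Nat.cast_one]
  field_simp

theorem cesaroNumber_pos {s : ℝ} (hs : 0 < s) (n : ℕ) : 0 < cesaroNumber s n := by
  unfold cesaroNumber
  have : 0 < ∏ i ∈ Finset.range n, (s + i) := Finset.prod_pos fun i _ => by positivity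
  positivity

theorem cesaroNumber_eq_choose (s : ℝ) (n : ℕ) :
    cesaroNumber s n = Ring.choose (s + n - 1) n := by
  have h1 : (n.factorial : ℝ) ≠ 0 := by exact_mod_cast n.factorial_ne_zero
  rw [← Ring.multichoose_eq, cesaroNumber, div_eq_iff h1]
  have h := Ring.factorial_nsmul_multichoose_eq_ascPochhammer s n
  rw [nsmul_eq_mul, Polynomial.ascPochhammer_smeval_eq_eval] at h
  rw [mul_comm, h]
  clear h h1
  induction n with
  | zero => simp
  | succ n ih => rw [Finset.prod_range_succ, ih, ascPochhammer_succ_eval]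

theorem hasSum_cesaroNumber (s : ℝ) {t : ℝ} (ht : |t| < 1) :
    HasSum (fun n => cesaroNumber s n * t ^ n) ((1 - t) ^ (-s)) := by
  have h := (Real.one_div_one_sub_rpow_hasFPowerSeriesOnBall_zero s).hasSum (y := t) (by
    simpa [enorm_eq_nnnorm, ← NNReal.coe_lt_coe] using ht)
  have h0 : 0 ≤ 1 - t := by linarith [(abs_lt.mp ht).2]
  rw [Real.rpow_neg h0]
  simpa [cesaroNumber_eq_choose, mul_comm] using h

theorem cesaroNumber_le_mul_succ {s : ℝ} (hs : 0 < s) :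
    ∃ C : ℝ, ∀ n, cesaroNumber s n ≤ C * cesaroNumber s (n + 1) := by
  refine ⟨1 / s + 1, fun n => ?_⟩
  have h := cesaroNumber_succ s n
  have hp := cesaroNumber_pos hs n
  have hp' := cesaroNumber_pos hs (n + 1)
  have hsn : (0 : ℝ) < s + n := by positivity
  have : cesaroNumber s n = ((n : ℝ) + 1) / (s + n) * cesaroNumber s (n + 1) := by
    field_simp
    linarith
  rw [this]
  refine mul_le_mul_of_nonneg_right ?_ hp'.le
  rw [div_le_iff₀ hsn]
  have h2 : (1 / s + 1) * (s + n) = 1 + s + n + n / s := by field_simp; ring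
  have : (0 : ℝ) ≤ n / s := by positivity
  linarith

/-! ### The weighted space `𝓗_k` and its backward shift -/

/-- The power series `f` with `∑ |f_n|² k_n < ∞`. -/
noncomputable def weightedSubmodule (k : ℕ → ℝ) (hk : ∀ n, 0 < k n) :
    Submodule ℂ (PowerSeries ℂ) where
  carrier := {f | Summable fun n => ‖PowerSeries.coeff n f‖ ^ 2 * k n}
  zero_mem' := by simp
  add_mem' := by
    intro f g hf hg
    refine Summable.of_nonneg_of_le (fun n => by have := hk n; positivity) (fun n => ?_)
      ((hf.add hg).mul_left 2)
    have h1 : ‖PowerSeries.coeff n f + PowerSeries.coeff n g‖ ^ 2 ≤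
        2 * (‖PowerSeries.coeff n f‖ ^ 2 + ‖PowerSeries.coeff n g‖ ^ 2) := by
      have := norm_add_le (PowerSeries.coeff n f) (PowerSeries.coeff n g)
      nlinarith [norm_nonneg (PowerSeries.coeff n f + PowerSeries.coeff n g),
        sq_nonneg (‖PowerSeries.coeff n f‖ - ‖PowerSeries.coeff n g‖)]
    have := mul_le_mul_of_nonneg_right h1 (hk n).le
    simp only [map_add]
    linarith
  smul_mem' := by
    intro c f hf
    refine (hf.mul_left (‖c‖ ^ 2)).congr fun n => ?_
    simp [mul_pow, mul_assoc]

/-- The weighted Hilbert space `𝓗_k` of power series `f(t) = ∑ f_n t^n` with norm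
`‖f‖² = ∑ |f_n|² k_n`, where `k_n > 0`. -/
def WeightedSpace (k : ℕ → ℝ) (hk : ∀ n, 0 < k n) : Type :=
  weightedSubmodule k hk

namespace WeightedSpace

variable {k : ℕ → ℝ} {hk : ∀ n, 0 < k n}

noncomputable instance : AddCommGroup (WeightedSpace k hk) :=
  inferInstanceAs (AddCommGroup (weightedSubmodule k hk))

noncomputable instance : Module ℂ (WeightedSpace k hk) :=
  inferInstanceAs (Module ℂ (weightedSubmodule k hk))

/-- The Taylor coefficient `f_n`. -/
noncomputable def coeff (n : ℕ) : WeightedSpace k hk →ₗ[ℂ] ℂ :=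
  (PowerSeries.coeff n).comp (weightedSubmodule k hk).subtype

theorem summable (f : WeightedSpace k hk) : Summable fun n => ‖coeff n f‖ ^ 2 * k n :=
  f.2

theorem ext {f g : WeightedSpace k hk} (h : ∀ n, coeff n f = coeff n g) : f = g :=
  Subtype.ext (PowerSeries.ext h)

/-- The element of `𝓗_k` with given coefficients. -/
noncomputable def ofCoeff (u : ℕ → ℂ) (hu : Summable fun n => ‖u n‖ ^ 2 * k n) :
    WeightedSpace k hk :=
  ⟨PowerSeries.mk u, by simpa [weightedSubmodule] using hu⟩

@[simp]
theorem coeff_ofCoeff (u : ℕ → ℂ) (hu : Summable fun n => ‖u n‖ ^ 2 * k n) (n : ℕ) :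
    coeff n (ofCoeff (hk := hk) u hu) = u n := by
  exact PowerSeries.coeff_mk n u

theorem norm_sqrt_mul_sq (hk : ∀ n, 0 < k n) (n : ℕ) (z : ℂ) :
    ‖((Real.sqrt (k n) : ℝ) : ℂ) * z‖ ^ 2 = ‖z‖ ^ 2 * k n := by
  rw [norm_mul, mul_pow, Complex.norm_real, Real.norm_eq_abs, sq_abs, Real.sq_sqrt (hk n).le,
    mul_comm]

theorem memℓp_two_iff (u : ℕ → ℂ) :
    Memℓp u 2 ↔ Summable fun n => ‖u n‖ ^ 2 := by
  rw [memℓp_gen_iff (by norm_num)]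
  simp

/-- The identification `f ↦ (√k_n f_n)` of `𝓗_k` with `ℓ²`, which transports the Hilbert space
structure to `𝓗_k`. -/
noncomputable def toEll2 : WeightedSpace k hk ≃ₗ[ℂ] lp (fun _ : ℕ => ℂ) 2 where
  toFun f := ⟨fun n => ((Real.sqrt (k n) : ℝ) : ℂ) * coeff n f, by
    refine (memℓp_two_iff _).2 ?_
    simpa only [norm_sqrt_mul_sq hk] using f.summable⟩
  map_add' f g := by
    ext n
    exact (by simp [mul_add] : ((Real.sqrt (k n) : ℝ) : ℂ) * coeff n (f + g) =
      ((Real.sqrt (k n) : ℝ) : ℂ) * coeff n f + ((Real.sqrt (k n) : ℝ) : ℂ) * coeff n g)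
  map_smul' c f := by
    ext n
    simp [mul_left_comm]
  invFun u := ofCoeff (fun n => ((Real.sqrt (k n) : ℝ) : ℂ)⁻¹ * u n) (by
    refine ((memℓp_two_iff _).1 (lp.memℓp u)).congr fun n => ?_
    have h : ((Real.sqrt (k n) : ℝ) : ℂ) ≠ 0 := by
      exact_mod_cast (Real.sqrt_pos.2 (hk n)).ne'
    rw [← norm_sqrt_mul_sq hk, mul_inv_cancel_left₀ h])
  left_inv f := by
    refine ext fun n => ?_
    have h : ((Real.sqrt (k n) : ℝ) : ℂ) ≠ 0 := by
      exact_mod_cast (Real.sqrt_pos.2 (hk n)).ne'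
    simp [h]
  right_inv u := by
    ext n
    have h : ((Real.sqrt (k n) : ℝ) : ℂ) ≠ 0 := by
      exact_mod_cast (Real.sqrt_pos.2 (hk n)).ne'
    simp [h]

noncomputable instance : NormedAddCommGroup (WeightedSpace k hk) :=
  NormedAddCommGroup.induced _ _ (toEll2 (k := k) (hk := hk)).toLinearMap.toAddMonoidHom
    toEll2.injective

theorem norm_toEll2 (f : WeightedSpace k hk) : ‖toEll2 f‖ = ‖f‖ := rfl

noncomputable instance : InnerProductSpace ℂ (WeightedSpace k hk) where
  norm_smul_le c f := by
    rw [← norm_toEll2, ← norm_toEll2, map_smul]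
    exact norm_smul_le _ _
  inner f g := inner ℂ (toEll2 f) (toEll2 g)
  norm_sq_eq_re_inner f := norm_sq_eq_re_inner (𝕜 := ℂ) (toEll2 f)
  conj_inner_symm f g := inner_conj_symm (toEll2 f) (toEll2 g)
  add_left f g h := by simp
  smul_left f g c := by simp [mul_comm]

theorem norm_sq_eq (f : WeightedSpace k hk) : ‖f‖ ^ 2 = ∑' n, ‖coeff n f‖ ^ 2 * k n := by
  have h := lp.norm_rpow_eq_tsum (p := 2) (by norm_num) (toEll2 f)
  simp only [ENNReal.toReal_ofNat, Real.rpow_ofNat] at h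
  rw [← norm_toEll2, h]
  exact tsum_congr fun n => norm_sqrt_mul_sq hk n _

instance : CompleteSpace (WeightedSpace k hk) := by
  let e : WeightedSpace k hk ≃ₗᵢ[ℂ] lp (fun _ : ℕ => ℂ) 2 := ⟨toEll2, norm_toEll2⟩
  exact e.toIsometryEquiv.completeSpace

/-- The backward shift `(B_k f)(t) = (f(t) - f(0)) / t` on `𝓗_k`, which is bounded when
`k_n / k_{n+1}` is bounded. -/
noncomputable def backwardShift (hb : ∃ C : ℝ, ∀ n, k n ≤ C * k (n + 1)) :
    WeightedSpace k hk →L[ℂ] WeightedSpace k hk :=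
  have hC : ∀ (f : WeightedSpace k hk) (n : ℕ), ‖coeff (n + 1) f‖ ^ 2 * k n ≤
      hb.choose * (‖coeff (n + 1) f‖ ^ 2 * k (n + 1)) := fun f n => by
    have := mul_le_mul_of_nonneg_left (hb.choose_spec n) (sq_nonneg ‖coeff (n + 1) f‖)
    linarith
  have hs : ∀ f : WeightedSpace k hk, Summable fun n => ‖coeff (n + 1) f‖ ^ 2 * k n := fun f =>
    Summable.of_nonneg_of_le (fun n => by have := hk n; positivity) (hC f)
      (((summable_nat_add_iff 1).2 f.summable).mul_left hb.choose)
  LinearMap.mkContinuousOfExistsBound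
    { toFun := fun f => ofCoeff (fun n => coeff (n + 1) f) (hs f)
      map_add' := fun f g => ext fun n => by simp
      map_smul' := fun c f => ext fun n => by simp }
    (by
      have h0 : 0 ≤ hb.choose := by
        by_contra h
        have h1 := hb.choose_spec 0
        have h2 := hk 0
        have h3 := hk (0 + 1)
        nlinarith
      refine ⟨Real.sqrt hb.choose, fun f => ?_⟩
      refine le_of_sq_le_sq ?_ (by positivity)
      rw [mul_pow, Real.sq_sqrt h0, norm_sq_eq, norm_sq_eq]
      simp only [LinearMap.coe_mk, AddHom.coe_mk, coeff_ofCoeff]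
      have hs1 := (summable_nat_add_iff 1).2 f.summable
      calc ∑' n, ‖coeff (n + 1) f‖ ^ 2 * k n
          ≤ ∑' n, hb.choose * (‖coeff (n + 1) f‖ ^ 2 * k (n + 1)) :=
            (hs f).tsum_le_tsum (hC f) (hs1.mul_left _)
        _ = hb.choose * ∑' n, ‖coeff (n + 1) f‖ ^ 2 * k (n + 1) := tsum_mul_left
        _ ≤ hb.choose * ∑' n, ‖coeff n f‖ ^ 2 * k n := by
            refine mul_le_mul_of_nonneg_left ?_ h0
            rw [f.summable.tsum_eq_zero_add]
            have := hk 0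
            have : 0 ≤ ‖coeff 0 f‖ ^ 2 * k 0 := by positivity
            linarith)

@[simp]
theorem coeff_backwardShift (hb : ∃ C : ℝ, ∀ n, k n ≤ C * k (n + 1)) (f : WeightedSpace k hk)
    (n : ℕ) : coeff n (backwardShift hb f) = coeff (n + 1) f := by
  simp [backwardShift]

end WeightedSpace

/-- The space `𝓗_a`, i.e. `𝓗_k` for `k(t) = (1 - t) ^ (-a)`. -/
abbrev PowerSeriesSpace (a : ℝ) (ha : 0 < a) : Type :=
  WeightedSpace (cesaroNumber a) (cesaroNumber_pos ha)

/-- The backward shift `B_a` on `𝓗_a`. -/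
noncomputable def backwardShift (a : ℝ) (ha : 0 < a) : PowerSeriesSpace a ha →L[ℂ] PowerSeriesSpace a ha :=
  WeightedSpace.backwardShift (cesaroNumber_le_mul_succ ha)

/-! ### Hilbert space tensor products, direct sums, parts of operators -/

/-- The Hilbert space tensor product: the completion of the algebraic tensor product for the
inner product `⟪x ⊗ y, x' ⊗ y'⟫ = ⟪x, x'⟫ ⟪y, y'⟫`. -/
abbrev HilbertTensor (X E : Type*) [NormedAddCommGroup X] [InnerProductSpace ℂ X]
    [NormedAddCommGroup E] [InnerProductSpace ℂ E] : Type _ :=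
  UniformSpace.Completion (X ⊗[ℂ] E)

/-- The operator `A ⊗ I_E` on the Hilbert space tensor product. -/
noncomputable def tensorId {X : Type*} [NormedAddCommGroup X] [InnerProductSpace ℂ X]
    (A : X →L[ℂ] X) (E : Type*) [NormedAddCommGroup E] [InnerProductSpace ℂ E] :
    HilbertTensor X E →L[ℂ] HilbertTensor X E :=
  (A.rTensor E).completion

/-- The orthogonal direct sum `A ⊕ S` on the Hilbert space `X ⊕ Y`. -/
noncomputable def directSum {X Y : Type*} [NormedAddCommGroup X] [InnerProductSpace ℂ X]
    [NormedAddCommGroup Y] [InnerProductSpace ℂ Y] (A : X →L[ℂ] X) (S : Y →L[ℂ] Y) :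
    WithLp 2 (X × Y) →L[ℂ] WithLp 2 (X × Y) :=
  (WithLp.prodContinuousLinearEquiv 2 ℂ X Y).symm.toContinuousLinearMap ∘L
    (A.prodMap S) ∘L (WithLp.prodContinuousLinearEquiv 2 ℂ X Y).toContinuousLinearMap

/-- `T` is unitarily equivalent to a part of `A`, i.e. to the restriction of `A` to a closed
invariant subspace `M`. -/
def IsUnitarilyEquivalentToPart {H X : Type*} [NormedAddCommGroup H] [InnerProductSpace ℂ H]
    [NormedAddCommGroup X] [InnerProductSpace ℂ X] (T : H →L[ℂ] H) (A : X →L[ℂ] X) : Prop :=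
  ∃ (M : Submodule ℂ X) (hM : ∀ x ∈ M, A.toLinearMap x ∈ M) (U : H ≃ₗᵢ[ℂ] M),
    IsClosed (M : Set X) ∧ ∀ h : H, U (T h) = A.toLinearMap.restrict hM (U h)

/-! ### `a`-contractions, the defect operator and the defect space -/

section Hereditary

variable {H : Type*} [NormedAddCommGroup H] [InnerProductSpace ℂ H] [CompleteSpace H]

/-- The series `∑ α_n T*ⁿ Tⁿ` converges to `A` in the strong operator topology. -/
def HasHereditarySum (α : ℕ → ℝ) (T A : H →L[ℂ] H) : Prop :=
  ∀ x : H, Tendsto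
    (fun N => (∑ n ∈ Finset.range N,
      (α n : ℂ) • ((ContinuousLinearMap.adjoint T) ^ n * T ^ n)) x) atTop (𝓝 (A x))

open Classical in
/-- The operator `α(T*, T) = ∑ α_n T*ⁿ Tⁿ` (strong operator topology); `0` by convention if the
series does not converge. -/
noncomputable def hereditary (α : ℕ → ℝ) (T : H →L[ℂ] H) : H →L[ℂ] H :=
  if h : ∃ A, HasHereditarySum α T A then h.choose else 0

/-- `T` is an `a`-contraction: with `α(t) = (1 - t) ^ a`, the series `α(T*, T)` converges in the
strong operator topology and its sum is a non-negative operator. -/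
def IsAContraction (a : ℝ) (T : H →L[ℂ] H) : Prop :=
  ∃ A : H →L[ℂ] H, HasHereditarySum (cesaroNumber (-a)) T A ∧ A.IsPositive

/-- The defect operator `D = ((1 - t) ^ a (T*, T)) ^ (1/2)`. -/
noncomputable def defectOperator (a : ℝ) (T : H →L[ℂ] H) : H →L[ℂ] H :=
  CFC.sqrt (hereditary (cesaroNumber (-a)) T)

/-- The defect space, the closure of the range of the defect operator. -/
noncomputable abbrev defectSpace (a : ℝ) (T : H →L[ℂ] H) : Submodule ℂ H :=
  (defectOperator a T).range.topologicalClosure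

end Hereditary

/-- For some isometry `S` on some Hilbert space, `T` is unitarily equivalent to a part of
`(B_a ⊗ I_E) ⊕ S`. -/
def HasModel {H : Type u} [NormedAddCommGroup H] [InnerProductSpace ℂ H]
    (a : ℝ) (ha : 0 < a) (T : H →L[ℂ] H)
    (E : Type u) [NormedAddCommGroup E] [InnerProductSpace ℂ E] : Prop :=
  ∃ (K : Type u) (_ : NormedAddCommGroup K) (_ : InnerProductSpace ℂ K) (_ : CompleteSpace K)
    (S : K →ₗᵢ[ℂ] K),
    IsUnitarilyEquivalentToPart T
      (directSum (tensorId (backwardShift a ha) E) S.toContinuousLinearMap)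

/-! Write `k_n = cesaroNumber a n`, `α_n = cesaroNumber (-a) n`, `c_n = cesaroNumber (-a + 1) n`.
Everything rests on the signs `k_n > 0`, `c_n > 0`, `α_0 = 1`, `α_n ≤ 0` for `n ≥ 1`, which hold
because `0 < a < 1`.

From an `a`-contraction to the model: fix `x` and put `u_n = ‖Tⁿ x‖²`, `d_m = ∑ α_n u_{n+m} = ‖D Tᵐ
x‖²`. Inverting `(1 - t) ^ a` gives `u_0 = ∑_{m ≤ M} k_m d_m + R_M` with an explicit nonnegative
remainder (`sum_add_inversionRemainder`). Hence `V x = (D Tⁿ x)_n` is a contraction into `𝓗_a ⊗ 𝔇`,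
and it intertwines `T` with `B_a ⊗ I`. Replacing `x` by `T x` does not change `lim R_M = ‖x‖² - ‖V
x‖²` (`sub_tsum_shift_eq`). So with `L = (1 - V*V) ^ (1/2)` one has `‖L T x‖ = ‖L x‖`, and `L x ↦ L
T x` extends to an isometry `S` on the closure of the range of `L`. The map `x ↦ (V x, L x)` is the
required embedding.

Conversely, for a part of `(B_a ⊗ I) ⊕ S` the partial sums of `∑ α_n ‖Tⁿ x‖²` are nonnegative on
each summand. As `α_n ≤ 0` for `n ≥ 1`, the operator partial sums decrease and stay nonnegative, so
they converge strongly (`exists_hasHereditarySum_of_sum_nonneg`). -/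

/-! ### Identities between the Taylor coefficients -/

@[simp]
theorem cesaroNumber_zero (s : ℝ) : cesaroNumber s 0 = 1 := by simp [cesaroNumber]

/-- Coefficient form of `d/dt (1 - t) ^ (-s) = s (1 - t) ^ (-s - 1)`. -/
theorem cesaroNumber_succ_eq_shift (s : ℝ) (n : ℕ) :
    ((n : ℝ) + 1) * cesaroNumber s (n + 1) = s * cesaroNumber (s + 1) n := by
  have h1 : (n.factorial : ℝ) ≠ 0 := by exact_mod_cast n.factorial_ne_zero
  have h2 : (n : ℝ) + 1 ≠ 0 := by positivity
  have h3 : ∏ i ∈ Finset.range n, (s + ((i : ℝ) + 1)) = ∏ i ∈ Finset.range n, (s + 1 + i) :=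
    Finset.prod_congr rfl fun i _ => by ring
  simp only [cesaroNumber, Finset.prod_range_succ', Nat.factorial_succ, Nat.cast_mul,
    Nat.cast_add, Nat.cast_one, Nat.cast_zero, add_zero, h3]
  field_simp

theorem cesaroNumber_add_one_succ (s : ℝ) (n : ℕ) :
    cesaroNumber (s + 1) (n + 1) = cesaroNumber (s + 1) n + cesaroNumber s (n + 1) := by
  have h2 : (n : ℝ) + 1 ≠ 0 := by positivity
  apply mul_left_cancel₀ h2
  rw [mul_add, cesaroNumber_succ_eq_shift s n, cesaroNumber_succ (s + 1) n]
  ring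

/-- Summing coefficients amounts to dividing the series by `1 - t`. -/
theorem sum_range_succ_cesaroNumber (s : ℝ) (n : ℕ) :
    ∑ i ∈ Finset.range (n + 1), cesaroNumber s i = cesaroNumber (s + 1) n := by
  induction n with
  | zero => simp
  | succ n ih => rw [Finset.sum_range_succ, ih, cesaroNumber_add_one_succ]

theorem cesaroNumber_neg_succ_nonpos {a : ℝ} (ha₀ : 0 < a) (ha₁ : a < 1) (n : ℕ) :
    cesaroNumber (-a) (n + 1) ≤ 0 := by
  have h := cesaroNumber_succ_eq_shift (-a) n
  have hp := cesaroNumber_pos (s := -a + 1) (by linarith) n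
  have h2 : (0 : ℝ) < (n : ℝ) + 1 := by positivity
  by_contra hc
  push Not at hc
  nlinarith [mul_pos h2 hc, mul_pos ha₀ hp]

theorem cesaroNumber_eq_neg_one_pow_mul_choose (s : ℝ) (n : ℕ) :
    cesaroNumber s n = (-1) ^ n * Ring.choose (-s) n := by
  rw [cesaroNumber_eq_choose, Ring.choose_neg, Units.smul_def, zsmul_eq_mul, ← mul_assoc]
  have h : (-1 : ℝ) ^ n * (((n : ℤ).negOnePow : ℤ) : ℝ) = 1 := by
    rw [Int.coe_negOnePow_natCast]
    push_cast
    rw [← mul_pow]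
    norm_num
  rw [h, one_mul]

/-- Coefficient form of `(1 - t) ^ s (1 - t) ^ (-s) = 1`, obtained from the Chu–Vandermonde identity
for the exponents `s` and `-s`. -/
theorem sum_antidiagonal_cesaroNumber (s : ℝ) (n : ℕ) :
    ∑ p ∈ Finset.HasAntidiagonal.antidiagonal n, cesaroNumber (-s) p.1 * cesaroNumber s p.2 =
      if n = 0 then 1 else 0 := by
  have h := Ring.add_choose_eq n (Commute.all s (-s))
  rw [add_neg_cancel, Ring.choose_zero_ite] at h
  have h2 : ∀ p ∈ Finset.HasAntidiagonal.antidiagonal n, cesaroNumber (-s) p.1 * cesaroNumber s p.2 =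
      (-1) ^ n * (Ring.choose s p.1 * Ring.choose (-s) p.2) := by
    intro p hp
    rw [← Finset.HasAntidiagonal.mem_antidiagonal.1 hp, cesaroNumber_eq_neg_one_pow_mul_choose,
      cesaroNumber_eq_neg_one_pow_mul_choose, neg_neg, pow_add]
    ring
  rw [Finset.sum_congr rfl h2, ← Finset.mul_sum, ← h]
  split_ifs with h0 <;> simp [h0]

/-! ### The remainder in the inversion of `(1 - t) ^ a` -/

/-- The nonnegative remainder `u₀ - ∑_{m ≤ M} k_m d_m`, where `d_m = ∑ α_n u_{n+m}`. -/
noncomputable def inversionRemainder (a : ℝ) (u : ℕ → ℝ) (M : ℕ) : ℝ :=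
  ((M : ℝ) + 1) * cesaroNumber a (M + 1) *
    ∑' i, cesaroNumber (-a + 1) i * u (M + 1 + i) / ((M : ℝ) + 1 + i)

section Remainder

variable {a : ℝ} {u : ℕ → ℝ}

/-- Since `c_i = -(i + 1) α_{i+1} / a`, the terms are dominated by `-α_{i+1} u_{M+1+i} / a`, the
tail of the series for `d_M`. -/
theorem summable_inversionRemainder (ha₀ : 0 < a) (ha₁ : a < 1) (hu : ∀ n, 0 ≤ u n)
    (hs : ∀ m, Summable fun n => cesaroNumber (-a) n * u (n + m)) (M : ℕ) :
    Summable fun i : ℕ => cesaroNumber (-a + 1) i * u (M + 1 + i) / ((M : ℝ) + 1 + i) := by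
  have h1 := (((summable_nat_add_iff 1).2 (hs M)).neg).mul_left a⁻¹
  refine Summable.of_nonneg_of_le (fun i => ?_) (fun i => ?_) h1
  · have := cesaroNumber_pos (s := -a + 1) (by linarith) i
    have := hu (M + 1 + i)
    positivity
  · have e : i + 1 + M = M + 1 + i := by ring
    have hsh := cesaroNumber_succ_eq_shift (-a) i
    have hv := hu (M + 1 + i)
    have hc := cesaroNumber_neg_succ_nonpos ha₀ ha₁ i
    have h3 : cesaroNumber (-a + 1) i = a⁻¹ * (-(((i : ℝ) + 1) * cesaroNumber (-a) (i + 1))) := by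
      rw [hsh]; field_simp
    rw [e, h3, div_le_iff₀ (by positivity)]
    have h4 : 0 ≤ a⁻¹ * (-cesaroNumber (-a) (i + 1)) * u (M + 1 + i) * M := by
      have : 0 ≤ -cesaroNumber (-a) (i + 1) := by linarith
      positivity
    nlinarith

theorem inversionRemainder_nonneg (ha₀ : 0 < a) (ha₁ : a < 1) (hu : ∀ n, 0 ≤ u n) (M : ℕ) :
    0 ≤ inversionRemainder a u M := by
  have := cesaroNumber_pos ha₀ (M + 1)
  refine mul_nonneg (by positivity) (tsum_nonneg fun i => ?_)
  have := cesaroNumber_pos (s := -a + 1) (by linarith) i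
  have := hu (M + 1 + i)
  positivity

theorem inversionRemainder_zero
    (hs : ∀ m, Summable fun n => cesaroNumber (-a) n * u (n + m)) :
    inversionRemainder a u 0 + ∑' n, cesaroNumber (-a) n * u n = u 0 := by
  have h0 : Summable fun n => cesaroNumber (-a) n * u n := hs 0
  have hk : cesaroNumber a 1 = a := by simp [cesaroNumber]
  rw [h0.tsum_eq_zero_add, inversionRemainder, ← tsum_mul_left, zero_add, hk]
  have h : ∀ i : ℕ, (((0 : ℕ) : ℝ) + 1) * a * (cesaroNumber (-a + 1) i * u (0 + 1 + i) /
      (((0 : ℕ) : ℝ) + 1 + i)) = -(cesaroNumber (-a) (i + 1) * u (i + 1)) := by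
    intro i
    have hsh := cesaroNumber_succ_eq_shift (-a) i
    have e : 0 + 1 + i = i + 1 := by ring
    have h2 : (i : ℝ) + 1 ≠ 0 := by positivity
    rw [e, Nat.cast_zero, zero_add, add_comm (1 : ℝ) i, one_mul, mul_div_assoc', div_eq_iff h2]
    linear_combination u (i + 1) * hsh
  rw [tsum_congr h, tsum_neg]
  simp

theorem inversionRemainder_succ (ha₀ : 0 < a) (ha₁ : a < 1) (hu : ∀ n, 0 ≤ u n)
    (hs : ∀ m, Summable fun n => cesaroNumber (-a) n * u (n + m)) (M : ℕ) :
    inversionRemainder a u (M + 1) +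
      cesaroNumber a (M + 1) * ∑' n, cesaroNumber (-a) n * u (n + (M + 1)) =
      inversionRemainder a u M := by
  have h1 := summable_inversionRemainder ha₀ ha₁ hu hs M
  have h2 := summable_inversionRemainder ha₀ ha₁ hu hs (M + 1)
  have h3 := hs (M + 1)
  have hk := cesaroNumber_succ a (M + 1)
  have hM : (M : ℝ) + 1 ≠ 0 := by positivity
  rw [inversionRemainder, inversionRemainder, h1.tsum_eq_zero_add, h3.tsum_eq_zero_add]
  -- By `c_{i+1} = c_i + α_{i+1}`, term `i + 1` of the old remainder splits into term `i` of the new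
  -- one and term `i + 1` of `k_{M+1} d_{M+1}`. The leftover term `0` of the old remainder is
  -- `k_{M+1} u_{M+1}`, which matches `α_0 = 1`.
  have key : ∀ i : ℕ, ((M : ℝ) + 1) * cesaroNumber a (M + 1) *
      (cesaroNumber (-a + 1) (i + 1) * u (M + 1 + (i + 1)) / ((M : ℝ) + 1 + ((i + 1 : ℕ) : ℝ))) =
      (((M + 1 : ℕ) : ℝ) + 1) * cesaroNumber a (M + 1 + 1) *
      (cesaroNumber (-a + 1) i * u (M + 1 + 1 + i) / (((M + 1 : ℕ) : ℝ) + 1 + i)) +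
      cesaroNumber a (M + 1) * (cesaroNumber (-a) (i + 1) * u (i + 1 + (M + 1))) := by
    intro i
    have e1 : M + 1 + (i + 1) = M + 1 + 1 + i := by ring
    have e2 : i + 1 + (M + 1) = M + 1 + 1 + i := by ring
    have hsh := cesaroNumber_succ_eq_shift (-a) i
    have hadd := cesaroNumber_add_one_succ (-a) i
    have hne : (M : ℝ) + 1 + 1 + i ≠ 0 := by positivity
    rw [e1, e2, hk, hadd]
    push_cast
    rw [show (M : ℝ) + 1 + (i + 1) = M + 1 + 1 + i by ring]
    field_simp
    linear_combination (-cesaroNumber a (M + 1) * u (M + 1 + 1 + i)) * hsh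
  have hsum := tsum_congr (L := .unconditional ℕ) key
  rw [Summable.tsum_add (h2.mul_left _) (((summable_nat_add_iff 1).2 h3).mul_left _),
    tsum_mul_left, tsum_mul_left, tsum_mul_left] at hsum
  rw [mul_add, mul_add, hsum]
  simp
  field_simp
  ring

/-- For `j > M` the coefficient of `u_j` in `u_0 - ∑_{m ≤ M} k_m d_m` is `-∑_{m ≤ M} k_m α_{j-m}`,
whose closed form is `(M + 1) k_{M+1} c_{j-M-1} / j`. Induction on `M` avoids rearranging double
series. -/
theorem sum_add_inversionRemainder (ha₀ : 0 < a) (ha₁ : a < 1) (hu : ∀ n, 0 ≤ u n)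
    (hs : ∀ m, Summable fun n => cesaroNumber (-a) n * u (n + m)) (M : ℕ) :
    ∑ m ∈ Finset.range (M + 1), cesaroNumber a m * ∑' n, cesaroNumber (-a) n * u (n + m) +
      inversionRemainder a u M = u 0 := by
  induction M with
  | zero =>
    have := inversionRemainder_zero hs
    simp
    linarith
  | succ M ih =>
    rw [Finset.sum_range_succ]
    have := inversionRemainder_succ ha₀ ha₁ hu hs M
    linarith

/-- Shifting the sequence changes the remainder by a factor that tends to `1`. -/
theorem inversionRemainder_shift_bounds (ha₀ : 0 < a) (ha₁ : a < 1) (hu : ∀ n, 0 ≤ u n)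
    (hs : ∀ m, Summable fun n => cesaroNumber (-a) n * u (n + m)) (M : ℕ) :
    ((M : ℝ) + 1 + a) / (M + 2) * inversionRemainder a (fun n => u (n + 1)) M ≤
        inversionRemainder a u (M + 1) ∧
      inversionRemainder a u (M + 1) ≤
        ((M : ℝ) + 1 + a) / (M + 1) * inversionRemainder a (fun n => u (n + 1)) M := by
  have hs' : ∀ m, Summable fun n => cesaroNumber (-a) n * (fun n => u (n + 1)) (n + m) :=
    fun m => by simpa only [add_assoc] using hs (m + 1)
  have h1 := summable_inversionRemainder ha₀ ha₁ (fun n => hu (n + 1)) hs' M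
  have h2 := summable_inversionRemainder ha₀ ha₁ hu hs (M + 1)
  have hk := cesaroNumber_succ a (M + 1)
  have hkp := cesaroNumber_pos ha₀ (M + 1)
  have hterm : ∀ i : ℕ, 0 ≤ cesaroNumber (-a + 1) i * u (M + 1 + 1 + i) := fun i =>
    mul_nonneg (cesaroNumber_pos (by linarith) i).le (hu _)
  have e : ∀ i, M + 1 + i + 1 = M + 1 + 1 + i := fun i => by ring
  simp only [e] at h1
  simp only [inversionRemainder, e, hk]
  simp only [← tsum_mul_left]
  -- The terms with index `i` have ratio `(M + 1 + a) / (M + 1)` times `(M + 1 + i) / (M + 2 + i)`.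
  -- The last factor is least at `i = 0` and stays below `1`, which gives the two constants.
  constructor
  · refine Summable.tsum_le_tsum (fun i => ?_) ((h1.mul_left _).mul_left _) (h2.mul_left _)
    calc _ = ((M : ℝ) + 1 + a) * cesaroNumber a (M + 1) *
          (cesaroNumber (-a + 1) i * u (M + 1 + 1 + i)) * ((M + 1) / ((M + 2) * (M + 1 + i))) := by
            field_simp
      _ ≤ ((M : ℝ) + 1 + a) * cesaroNumber a (M + 1) *
          (cesaroNumber (-a + 1) i * u (M + 1 + 1 + i)) * (1 / (M + 1 + 1 + i)) := by
            refine mul_le_mul_of_nonneg_left ?_ (mul_nonneg (by positivity) (hterm i))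
            rw [div_le_div_iff₀ (by positivity) (by positivity)]
            have : (0 : ℝ) ≤ i := by positivity
            linarith
      _ = _ := by push_cast; ring
  · refine Summable.tsum_le_tsum (fun i => ?_) (h2.mul_left _) ((h1.mul_left _).mul_left _)
    calc _ = ((M : ℝ) + 1 + a) * cesaroNumber a (M + 1) *
          (cesaroNumber (-a + 1) i * u (M + 1 + 1 + i)) * (1 / (M + 1 + 1 + i)) := by
            push_cast; ring
      _ ≤ ((M : ℝ) + 1 + a) * cesaroNumber a (M + 1) *
          (cesaroNumber (-a + 1) i * u (M + 1 + 1 + i)) * (1 / (M + 1 + i)) := by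
            refine mul_le_mul_of_nonneg_left ?_ (mul_nonneg (by positivity) (hterm i))
            exact one_div_le_one_div_of_le (by positivity) (by linarith)
      _ = _ := by field_simp

theorem summable_and_tsum_le (ha₀ : 0 < a) (ha₁ : a < 1) (hu : ∀ n, 0 ≤ u n)
    (hs : ∀ m, Summable fun n => cesaroNumber (-a) n * u (n + m))
    (hd : ∀ m, 0 ≤ ∑' n, cesaroNumber (-a) n * u (n + m)) :
    (Summable fun m => cesaroNumber a m * ∑' n, cesaroNumber (-a) n * u (n + m)) ∧
      ∑' m, cesaroNumber a m * ∑' n, cesaroNumber (-a) n * u (n + m) ≤ u 0 := by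
  have hnn : ∀ m, 0 ≤ cesaroNumber a m * ∑' n, cesaroNumber (-a) n * u (n + m) := fun m =>
    mul_nonneg (cesaroNumber_pos ha₀ m).le (hd m)
  have hb : ∀ N, ∑ m ∈ Finset.range N,
      cesaroNumber a m * ∑' n, cesaroNumber (-a) n * u (n + m) ≤ u 0 := by
    intro N
    have h1 := sum_add_inversionRemainder ha₀ ha₁ hu hs N
    have h2 := inversionRemainder_nonneg ha₀ ha₁ hu N
    rw [Finset.sum_range_succ] at h1
    linarith [hnn N]
  exact ⟨summable_of_sum_range_le hnn hb, Real.tsum_le_of_sum_range_le hnn hb⟩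

theorem tendsto_inversionRemainder (ha₀ : 0 < a) (ha₁ : a < 1) (hu : ∀ n, 0 ≤ u n)
    (hs : ∀ m, Summable fun n => cesaroNumber (-a) n * u (n + m))
    (hd : ∀ m, 0 ≤ ∑' n, cesaroNumber (-a) n * u (n + m)) :
    Tendsto (inversionRemainder a u) atTop
      (𝓝 (u 0 - ∑' m, cesaroNumber a m * ∑' n, cesaroNumber (-a) n * u (n + m))) := by
  have h := ((tendsto_add_atTop_iff_nat 1).2
    (summable_and_tsum_le ha₀ ha₁ hu hs hd).1.hasSum.tendsto_sum_nat).const_sub (u 0)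
  refine h.congr fun M => ?_
  linarith [sum_add_inversionRemainder ha₀ ha₁ hu hs M]

/-- The part of `u₀` not accounted for by the defects is invariant under the shift. -/
theorem sub_tsum_shift_eq (ha₀ : 0 < a) (ha₁ : a < 1) (hu : ∀ n, 0 ≤ u n)
    (hs : ∀ m, Summable fun n => cesaroNumber (-a) n * u (n + m))
    (hd : ∀ m, 0 ≤ ∑' n, cesaroNumber (-a) n * u (n + m)) :
    u 1 - ∑' m, cesaroNumber a m * ∑' n, cesaroNumber (-a) n * u (n + (m + 1)) =
      u 0 - ∑' m, cesaroNumber a m * ∑' n, cesaroNumber (-a) n * u (n + m) := by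
  have hs' : ∀ m, Summable fun n => cesaroNumber (-a) n * (fun n => u (n + 1)) (n + m) :=
    fun m => by simpa only [add_assoc] using hs (m + 1)
  have hd' : ∀ m, 0 ≤ ∑' n, cesaroNumber (-a) n * (fun n => u (n + 1)) (n + m) :=
    fun m => by simpa only [add_assoc] using hd (m + 1)
  have h1 := tendsto_inversionRemainder ha₀ ha₁ (fun n => hu (n + 1)) hs' hd'
  have h2 := (tendsto_add_atTop_iff_nat 1).2 (tendsto_inversionRemainder ha₀ ha₁ hu hs hd)
  have hb := inversionRemainder_shift_bounds ha₀ ha₁ hu hs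
  have hinv : ∀ c : ℝ, Tendsto (fun M : ℕ => ((M : ℝ) + 1 + a) / (M + c)) atTop (𝓝 1) := by
    intro c
    have hM : Tendsto (fun M : ℕ => (M : ℝ) + c) atTop atTop :=
      tendsto_atTop_add_const_right _ _ tendsto_natCast_atTop_atTop
    have h := (hM.inv_tendsto_atTop.const_mul (1 + a - c)).const_add 1
    rw [mul_zero, add_zero] at h
    refine h.congr' ?_
    filter_upwards [hM.eventually_ne_atTop 0] with M h0
    simp only [Pi.inv_apply]
    field_simp
    ring
  have l1 := ((hinv 2).mul h1)
  have l2 := ((hinv 1).mul h1)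
  simp only [one_mul, zero_add, add_assoc] at l1 l2
  refine le_antisymm ?_ ?_
  · exact le_of_tendsto_of_tendsto' l1 h2 fun M => by simpa only [add_assoc] using (hb M).1
  · exact le_of_tendsto_of_tendsto' h2 l2 fun M => by simpa only [add_assoc] using (hb M).2

end Remainder

/-! ### Hereditary sums -/

section HereditarySum

variable {H : Type*} [NormedAddCommGroup H] [InnerProductSpace ℂ H] [CompleteSpace H]

theorem ContinuousLinearMap.IsPositive.norm_sqrt_apply_sq {A : H →L[ℂ] H} (hA : A.IsPositive)
    (x : H) : ‖CFC.sqrt A x‖ ^ 2 = (inner ℂ (A x) x).re := by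
  have h0 : 0 ≤ A := (ContinuousLinearMap.nonneg_iff_isPositive A).2 hA
  have hs : (CFC.sqrt A).IsPositive :=
    (ContinuousLinearMap.nonneg_iff_isPositive _).1 (CFC.sqrt_nonneg A)
  have h1 : A x = CFC.sqrt A (CFC.sqrt A x) := by
    conv_lhs => rw [← CFC.sqrt_mul_sqrt_self A h0]
    rfl
  rw [h1, hs.isSymmetric.apply_clm (CFC.sqrt A x) x, ← inner_self_eq_norm_sq (𝕜 := ℂ)]
  rfl

/-- This is `P² ≤ P` for `0 ≤ P ≤ 1`: apply `P ≤ 1` to the vector `√P x`. -/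
theorem ContinuousLinearMap.IsPositive.norm_apply_sq_le {P : H →L[ℂ] H} (hP : P.IsPositive)
    (h1 : ∀ x, (inner ℂ (P x) x).re ≤ ‖x‖ ^ 2) (x : H) :
    ‖P x‖ ^ 2 ≤ (inner ℂ (P x) x).re := by
  have h0 : 0 ≤ P := (ContinuousLinearMap.nonneg_iff_isPositive P).2 hP
  have hx : P x = CFC.sqrt P (CFC.sqrt P x) := by
    conv_lhs => rw [← CFC.sqrt_mul_sqrt_self P h0]
    rfl
  have h2 := h1 (CFC.sqrt P x)
  rwa [← hP.norm_sqrt_apply_sq, ← hx, hP.norm_sqrt_apply_sq] at h2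

theorem inner_hereditaryTerm (T : H →L[ℂ] H) (n : ℕ) (x y : H) :
    inner ℂ (((ContinuousLinearMap.adjoint T) ^ n * T ^ n) x) y =
      inner ℂ ((T ^ n) x) ((T ^ n) y) := by
  have h : (ContinuousLinearMap.adjoint T) ^ n = ContinuousLinearMap.adjoint (T ^ n) := by
    simp only [← ContinuousLinearMap.star_eq_adjoint, star_pow]
  rw [h, mul_apply_eq_comp, ContinuousLinearMap.adjoint_inner_left]

theorem inner_sum_hereditaryTerm (α : ℕ → ℝ) (T : H →L[ℂ] H) (s : Finset ℕ) (x y : H) :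
    inner ℂ ((∑ n ∈ s, (α n : ℂ) • ((ContinuousLinearMap.adjoint T) ^ n * T ^ n)) x) y =
      ∑ n ∈ s, (α n : ℂ) * inner ℂ ((T ^ n) x) ((T ^ n) y) := by
  simp only [sum_apply, sum_inner]
  refine Finset.sum_congr rfl fun n _ => ?_
  rw [smul_apply, inner_smul_left, inner_hereditaryTerm, Complex.conj_ofReal]

theorem re_inner_sum_hereditaryTerm (α : ℕ → ℝ) (T : H →L[ℂ] H) (s : Finset ℕ) (x : H) :
    (inner ℂ ((∑ n ∈ s, (α n : ℂ) • ((ContinuousLinearMap.adjoint T) ^ n * T ^ n)) x) x).re =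
      ∑ n ∈ s, α n * ‖(T ^ n) x‖ ^ 2 := by
  rw [inner_sum_hereditaryTerm, Complex.re_sum]
  refine Finset.sum_congr rfl fun n _ => ?_
  rw [Complex.re_ofReal_mul, ← inner_self_eq_norm_sq (𝕜 := ℂ)]
  rfl

theorem isSymmetric_sum_hereditaryTerm (α : ℕ → ℝ) (T : H →L[ℂ] H) (s : Finset ℕ) :
    (∑ n ∈ s, (α n : ℂ) • ((ContinuousLinearMap.adjoint T) ^ n * T ^ n)).IsSymmetric := by
  intro x y
  have h := inner_sum_hereditaryTerm α T s y x
  rw [← inner_conj_symm x]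
  erw [inner_sum_hereditaryTerm α T s x y, h]
  simp [inner_conj_symm]

theorem HasHereditarySum.unique {α : ℕ → ℝ} {T A B : H →L[ℂ] H} (hA : HasHereditarySum α T A)
    (hB : HasHereditarySum α T B) : A = B :=
  ContinuousLinearMap.ext fun x => tendsto_nhds_unique (hA x) (hB x)

theorem HasHereditarySum.hereditary_eq {α : ℕ → ℝ} {T A : H →L[ℂ] H}
    (hA : HasHereditarySum α T A) : hereditary α T = A := by
  have h : ∃ A, HasHereditarySum α T A := ⟨A, hA⟩
  rw [hereditary, dif_pos h]
  exact h.choose_spec.unique hA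

/-- Strong convergence only concerns the ordered partial sums. All terms after the first have one
sign, so the scalar series converges unconditionally. -/
theorem HasHereditarySum.hasSum {α : ℕ → ℝ} (hα : ∀ n, α (n + 1) ≤ 0) {T A : H →L[ℂ] H}
    (hA : HasHereditarySum α T A) (x : H) :
    HasSum (fun n => α n * ‖(T ^ n) x‖ ^ 2) (inner ℂ (A x) x).re := by
  have h : Tendsto (fun N => ∑ n ∈ Finset.range N, α n * ‖(T ^ n) x‖ ^ 2) atTop
      (𝓝 (inner ℂ (A x) x).re) := by
    simp only [← re_inner_sum_hereditaryTerm]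
    exact (Complex.continuous_re.tendsto _).comp ((hA x).inner tendsto_const_nhds)
  have hs : Summable fun n => α n * ‖(T ^ n) x‖ ^ 2 := by
    rw [← summable_nat_add_iff 1, ← summable_neg_iff]
    have h1 := ((tendsto_add_atTop_iff_nat 1).2 h).neg.add_const (α 0 * ‖(T ^ 0) x‖ ^ 2)
    refine ((hasSum_iff_tendsto_nat_of_nonneg (fun n => ?_) _).2 (h1.congr fun N => ?_)).summable
    · have := hα n
      have : 0 ≤ (-α (n + 1)) * ‖(T ^ (n + 1)) x‖ ^ 2 := mul_nonneg (by linarith) (by positivity)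
      linarith
    · rw [Finset.sum_range_succ', Finset.sum_neg_distrib]
      ring
  exact (hs.hasSum_iff_tendsto_nat).2 h

/-- If `α_n ≤ 0` for `n ≥ 1` and all partial sums of `∑ α_n ‖Tⁿ x‖²` are nonnegative, then
`∑ α_n T*ⁿ Tⁿ` converges strongly, as a decreasing sequence of nonnegative operators. -/
theorem exists_hasHereditarySum_of_sum_nonneg {α : ℕ → ℝ} (h0 : α 0 = 1)
    (hα : ∀ n, α (n + 1) ≤ 0) (T : H →L[ℂ] H)
    (hT : ∀ N x, 0 ≤ ∑ n ∈ Finset.range N, α n * ‖(T ^ n) x‖ ^ 2) :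
    ∃ A : H →L[ℂ] H, HasHereditarySum α T A ∧ A.IsPositive := by
  set G : ℕ → H →L[ℂ] H := fun N =>
    ∑ n ∈ Finset.range N, (α n : ℂ) • ((ContinuousLinearMap.adjoint T) ^ n * T ^ n) with hG
  -- The index is shifted by one because `G 0 = 0`; the decrease starts at `G 1 = 1`.
  set f : H → ℕ → ℝ := fun x N => ∑ n ∈ Finset.range (N + 1), α n * ‖(T ^ n) x‖ ^ 2 with hf
  have hGf : ∀ N x, (inner ℂ (G (N + 1) x) x).re = f x N := fun N x =>
    re_inner_sum_hereditaryTerm α T _ x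
  have hanti : ∀ x, Antitone (f x) := fun x => antitone_nat_of_succ_le fun N => by
    simp only [hf]
    rw [Finset.sum_range_succ _ (N + 1)]
    have : α (N + 1) * ‖(T ^ (N + 1)) x‖ ^ 2 ≤ 0 :=
      mul_nonpos_of_nonpos_of_nonneg (hα N) (by positivity)
    linarith
  have hf0 : ∀ x, f x 0 = ‖x‖ ^ 2 := fun x => by simp [hf, h0]
  have hfn : ∀ x N, 0 ≤ f x N := fun x N => hT (N + 1) x
  -- The difference lies between `0` and `1`, so strong convergence is controlled by the convergence
  -- of the quadratic forms.
  have hdiff : ∀ M N, M ≤ N → ∀ x, ‖G (M + 1) x - G (N + 1) x‖ ^ 2 ≤ f x M - f x N := by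
    intro M N hMN x
    have hre : ∀ y, (inner ℂ ((G (M + 1) - G (N + 1)) y) y).re = f y M - f y N := fun y => by
      rw [sub_apply, inner_sub_left, Complex.sub_re, hGf, hGf]
    have hpos : (G (M + 1) - G (N + 1)).IsPositive := by
      refine ⟨?_, fun y => ?_⟩
      · exact (isSymmetric_sum_hereditaryTerm α T _).sub (isSymmetric_sum_hereditaryTerm α T _)
      · have := hre y
        have := hanti y hMN
        change 0 ≤ (inner ℂ ((G (M + 1) - G (N + 1)) y) y).re
        linarith
    have h := hpos.norm_apply_sq_le (fun y => by
      have := hanti y (Nat.zero_le M)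
      rw [hre]
      linarith [hf0 y, hfn y N]) x
    rwa [hre] at h
  have hcauchy : ∀ x, CauchySeq fun N => G (N + 1) x := by
    intro x
    have hfc : CauchySeq (f x) :=
      (tendsto_atTop_ciInf (hanti x) ⟨0, by rintro _ ⟨N, rfl⟩; exact hfn x N⟩).cauchySeq
    rw [Metric.cauchySeq_iff'] at hfc ⊢
    intro ε hε
    obtain ⟨N, hN⟩ := hfc (ε ^ 2) (by positivity)
    refine ⟨N, fun n hn => ?_⟩
    have h1 := hN n hn
    have h2 := hdiff N n hn x
    rw [Real.dist_eq, abs_sub_comm] at h1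
    rw [dist_comm, dist_eq_norm]
    exact lt_of_pow_lt_pow_left₀ 2 hε.le (lt_of_le_of_lt (h2.trans (le_abs_self _)) h1)
  choose g hg using fun x => cauchySeq_tendsto_of_complete (hcauchy x)
  have hlim : Tendsto (fun N x => G N x) atTop (𝓝 g) :=
    tendsto_pi_nhds.2 fun x => (tendsto_add_atTop_iff_nat 1).1 (hg x)
  -- The pointwise limit is bounded by the Banach–Steinhaus theorem.
  refine ⟨continuousLinearMapOfTendsto G hlim, fun x => tendsto_pi_nhds.1 hlim x, fun x y => ?_,
    fun x => ?_⟩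
  · have h1 := (tendsto_pi_nhds.1 hlim x).inner (𝕜 := ℂ) (tendsto_const_nhds (x := y))
    have h2 := (tendsto_const_nhds (x := x)).inner (𝕜 := ℂ) (tendsto_pi_nhds.1 hlim y)
    exact tendsto_nhds_unique h1 (h2.congr fun N =>
      (isSymmetric_sum_hereditaryTerm α T (Finset.range N) x y).symm)
  · have h1 := (Complex.continuous_re.tendsto _).comp
      ((tendsto_pi_nhds.1 hlim x).inner (𝕜 := ℂ) (tendsto_const_nhds (x := x)))
    refine ge_of_tendsto' h1 fun N => ?_
    have := hT N x
    rw [← re_inner_sum_hereditaryTerm] at this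
    exact this

end HereditarySum

/-! ### `𝓗_k ⊗ E` as a weighted space of `E`-valued sequences -/

namespace WeightedSpace

variable {k : ℕ → ℝ} {hk : ∀ n, 0 < k n}
variable {E : Type*} [NormedAddCommGroup E] [InnerProductSpace ℂ E]

theorem memℓp_two_smul (v : lp (fun _ : ℕ => ℂ) 2) (e : E) : Memℓp (fun n => v n • e) 2 := by
  rw [memℓp_gen_iff (by norm_num)]
  have h := ((memℓp_two_iff _).1 (lp.memℓp v)).mul_right (‖e‖ ^ 2)
  refine h.congr fun n => ?_
  simp [norm_smul, mul_pow]

/-- The linear map `f ⊗ e ↦ (√k_n f_n e)` on the algebraic tensor product. -/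
noncomputable def tensorToSeqLinear :
    WeightedSpace k hk ⊗[ℂ] E →ₗ[ℂ] lp (fun _ : ℕ => E) 2 :=
  TensorProduct.lift <| LinearMap.mk₂ ℂ
    (fun f e => (⟨fun n => toEll2 f n • e, memℓp_two_smul (toEll2 f) e⟩ : lp (fun _ : ℕ => E) 2))
    (fun f g e => by ext n; simp [add_smul]; rfl)
    (fun c f e => by ext n; simp [mul_smul])
    (fun f e e' => by ext n; simp; rfl)
    (fun c f e => by ext n; simp [smul_comm c])

theorem tensorToSeqLinear_tmul (f : WeightedSpace k hk) (e : E) (n : ℕ) :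
    tensorToSeqLinear (f ⊗ₜ[ℂ] e) n = toEll2 f n • e := rfl

theorem inner_tensorToSeqLinear (x y : WeightedSpace k hk ⊗[ℂ] E) :
    inner ℂ (tensorToSeqLinear x) (tensorToSeqLinear y) = inner ℂ x y := by
  induction x with
  | zero => simp
  | add x x' hx hx' => simp [inner_add_left, hx, hx']
  | tmul f e =>
    induction y with
    | zero => simp
    | add y y' hy hy' => simp [inner_add_right, hy, hy']
    | tmul g e' =>
      rw [TensorProduct.inner_tmul]
      refine (lp.hasSum_inner _ _).unique ?_
      have h : inner ℂ f g = inner ℂ (toEll2 f) (toEll2 g) := rfl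
      rw [h]
      have h2 := (lp.hasSum_inner (toEll2 f) (toEll2 g)).mul_right (inner ℂ e e')
      have h3 : ∀ n, inner ℂ (tensorToSeqLinear (f ⊗ₜ[ℂ] e) n) (tensorToSeqLinear (g ⊗ₜ[ℂ] e') n) =
          inner ℂ (toEll2 f n) (toEll2 g n) * inner ℂ e e' := fun n => by
        simp only [tensorToSeqLinear_tmul, inner_smul_left, inner_smul_right, RCLike.inner_apply]
        ring
      simp only [h3]
      exact h2

theorem norm_tensorToSeqLinear (x : WeightedSpace k hk ⊗[ℂ] E) :
    ‖tensorToSeqLinear x‖ = ‖x‖ := by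
  rw [← sq_eq_sq₀ (norm_nonneg _) (norm_nonneg _), ← inner_self_eq_norm_sq (𝕜 := ℂ),
    ← inner_self_eq_norm_sq (𝕜 := ℂ), inner_tensorToSeqLinear]

theorem exists_tensorToSeqLinear_eq_single (n : ℕ) (e : E) :
    ∃ x : WeightedSpace k hk ⊗[ℂ] E, tensorToSeqLinear x = lp.single 2 n e := by
  refine ⟨toEll2.symm (lp.single 2 n (1 : ℂ)) ⊗ₜ e, ?_⟩
  ext m
  rw [tensorToSeqLinear_tmul, LinearEquiv.apply_symm_apply]
  by_cases h : m = n
  · subst h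
    simp
  · simp [h]

variable [CompleteSpace E]

/-- The isometric extension of `tensorToSeqLinear` to the Hilbert space tensor product. -/
noncomputable def tensorToSeqIsometry :
    HilbertTensor (WeightedSpace k hk) E →ₗᵢ[ℂ] lp (fun _ : ℕ => E) 2 :=
  let F : HilbertTensor (WeightedSpace k hk) E →L[ℂ] lp (fun _ : ℕ => E) 2 :=
    tensorToSeqLinear.extendOfNorm (UniformSpace.Completion.toComplₗᵢ (𝕜 := ℂ)).toLinearMap
  have hF : ∀ x : WeightedSpace k hk ⊗[ℂ] E, F x = tensorToSeqLinear x :=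
    LinearMap.extendOfNorm_eq UniformSpace.Completion.denseRange_coe
      ⟨1, fun x => by simp [norm_tensorToSeqLinear]⟩
  { toLinearMap := F.toLinearMap
    norm_map' := fun y => by
      change ‖F y‖ = ‖y‖
      induction y using UniformSpace.Completion.induction_on with
      | hp => exact isClosed_eq (by fun_prop) (by fun_prop)
      | ih x => rw [hF, norm_tensorToSeqLinear, UniformSpace.Completion.norm_coe] }

theorem tensorToSeqIsometry_coe (x : WeightedSpace k hk ⊗[ℂ] E) :
    tensorToSeqIsometry (x : HilbertTensor (WeightedSpace k hk) E) = tensorToSeqLinear x :=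
  LinearMap.extendOfNorm_eq UniformSpace.Completion.denseRange_coe
    ⟨1, fun x => by simp [norm_tensorToSeqLinear]⟩ x

/-- The range of an isometry from a complete space is closed, and it contains every finitely
supported sequence. -/
theorem tensorToSeqIsometry_surjective :
    Function.Surjective (tensorToSeqIsometry (k := k) (hk := hk) (E := E)) := by
  intro v
  have hc : IsClosed (Set.range (tensorToSeqIsometry (k := k) (hk := hk) (E := E))) :=
    tensorToSeqIsometry.isometry.isClosedEmbedding.isClosed_range
  refine hc.mem_of_tendsto (lp.hasSum_single ENNReal.ofNat_ne_top v) (Eventually.of_forall ?_)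
  intro s
  change _ ∈ LinearMap.range tensorToSeqIsometry.toLinearMap
  refine Submodule.sum_mem _ fun n _ => ?_
  obtain ⟨x, hx⟩ := exists_tensorToSeqLinear_eq_single (k := k) (hk := hk) n (v n)
  exact ⟨x, by rw [← hx]; exact tensorToSeqIsometry_coe x⟩

variable (k hk E) in
/-- The Hilbert space `𝓗_k ⊗ E` is isometric to `ℓ²(E)` through `f ⊗ e ↦ (√k_n f_n e)`. -/
noncomputable def tensorEquivSeq :
    HilbertTensor (WeightedSpace k hk) E ≃ₗᵢ[ℂ] lp (fun _ : ℕ => E) 2 :=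
  LinearIsometryEquiv.ofSurjective tensorToSeqIsometry tensorToSeqIsometry_surjective

theorem tensorEquivSeq_coe (x : WeightedSpace k hk ⊗[ℂ] E) :
    tensorEquivSeq k hk E (x : HilbertTensor (WeightedSpace k hk) E) = tensorToSeqLinear x :=
  tensorToSeqIsometry_coe x

/-- The `n`-th coefficient `∑ f_n e` of `∑ f ⊗ e`, an element of `E`. -/
noncomputable def tensorCoeff (n : ℕ) : HilbertTensor (WeightedSpace k hk) E →L[ℂ] E :=
  (((Real.sqrt (k n))⁻¹ : ℝ) : ℂ) • ((lp.evalCLM ℂ (fun _ : ℕ => E) 2 n).comp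
    (tensorEquivSeq k hk E).toContinuousLinearEquiv.toContinuousLinearMap)

theorem tensorCoeff_apply (n : ℕ) (y : HilbertTensor (WeightedSpace k hk) E) :
    tensorCoeff n y = (((Real.sqrt (k n))⁻¹ : ℝ) : ℂ) • tensorEquivSeq k hk E y n := rfl

theorem tensorCoeff_tmul (n : ℕ) (f : WeightedSpace k hk) (e : E) :
    tensorCoeff n ((f ⊗ₜ[ℂ] e : WeightedSpace k hk ⊗[ℂ] E) :
      HilbertTensor (WeightedSpace k hk) E) = coeff n f • e := by
  have h : ((Real.sqrt (k n) : ℝ) : ℂ) ≠ 0 := by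
    exact_mod_cast (Real.sqrt_pos.2 (hk n)).ne'
  rw [tensorCoeff_apply, tensorEquivSeq_coe, tensorToSeqLinear_tmul, smul_smul]
  congr 1
  change _ * (((Real.sqrt (k n) : ℝ) : ℂ) * coeff n f) = _
  rw [Complex.ofReal_inv, inv_mul_cancel_left₀ h]

theorem hasSum_tensorCoeff (y : HilbertTensor (WeightedSpace k hk) E) :
    HasSum (fun n => k n * ‖tensorCoeff n y‖ ^ 2) (‖y‖ ^ 2) := by
  have h := lp.hasSum_norm (p := 2) (by norm_num) (tensorEquivSeq k hk E y)
  simp only [ENNReal.toReal_ofNat, Real.rpow_ofNat, LinearIsometryEquiv.norm_map] at h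
  convert h using 2 with n
  rw [tensorCoeff_apply, norm_smul, mul_pow, Complex.norm_real, Real.norm_eq_abs, sq_abs, inv_pow,
    Real.sq_sqrt (hk n).le, mul_inv_cancel_left₀ (hk n).ne']

theorem tensorEquivSeq_symm_coeff (v : lp (fun _ : ℕ => E) 2) (n : ℕ) :
    tensorCoeff n ((tensorEquivSeq k hk E).symm v) = (((Real.sqrt (k n))⁻¹ : ℝ) : ℂ) • v n := by
  rw [tensorCoeff_apply, LinearIsometryEquiv.apply_symm_apply]

theorem tensor_ext {y z : HilbertTensor (WeightedSpace k hk) E}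
    (h : ∀ n, tensorCoeff n y = tensorCoeff n z) : y = z := by
  have h1 := hasSum_tensorCoeff (y - z)
  simp only [map_sub, h, sub_self, norm_zero, ne_eq, OfNat.ofNat_ne_zero, not_false_eq_true,
    zero_pow, mul_zero] at h1
  have h2 := h1.unique hasSum_zero
  exact sub_eq_zero.1 (norm_eq_zero.1 (pow_eq_zero_iff two_ne_zero |>.1 h2))

theorem tensorCoeff_tensorId_backwardShift (hb : ∃ C : ℝ, ∀ n, k n ≤ C * k (n + 1)) (n : ℕ)
    (y : HilbertTensor (WeightedSpace k hk) E) :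
    tensorCoeff n (tensorId (backwardShift hb) E y) = tensorCoeff (n + 1) y := by
  induction y using UniformSpace.Completion.induction_on with
  | hp => exact isClosed_eq (by fun_prop) (by fun_prop)
  | ih x =>
    have h : ∀ x : WeightedSpace k hk ⊗[ℂ] E, tensorId (backwardShift hb) E
        (x : HilbertTensor (WeightedSpace k hk) E) =
        (((backwardShift hb).rTensor E x : WeightedSpace k hk ⊗[ℂ] E) :
          HilbertTensor (WeightedSpace k hk) E) := fun x => by
      simp [tensorId]
    rw [h]
    induction x with
    | zero => rw [map_zero, UniformSpace.Completion.coe_zero, map_zero, map_zero]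
    | add x y hx hy => simp only [map_add, UniformSpace.Completion.coe_add, hx, hy]
    | tmul f e =>
      have h2 : (backwardShift hb).rTensor E (f ⊗ₜ[ℂ] e) = (backwardShift hb f) ⊗ₜ[ℂ] e := rfl
      rw [h2, tensorCoeff_tmul, tensorCoeff_tmul, coeff_backwardShift]

theorem tensorCoeff_tensorId_backwardShift_pow (hb : ∃ C : ℝ, ∀ n, k n ≤ C * k (n + 1)) (m n : ℕ)
    (y : HilbertTensor (WeightedSpace k hk) E) :
    tensorCoeff n ((tensorId (backwardShift hb) E ^ m) y) = tensorCoeff (n + m) y := by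
  induction m generalizing n with
  | zero => simp
  | succ m ih =>
    rw [pow_succ', mul_apply_eq_comp, tensorCoeff_tensorId_backwardShift, ih]
    rw [show n + (m + 1) = n + 1 + m by ring]

end WeightedSpace

/-! ### Parts of `(B_a ⊗ I_E) ⊕ S` are `a`-contractions -/

section ModelToContraction

variable {a : ℝ}

/-- This is the coefficient of `‖y_j‖²` in `∑_{n < N} α_n ‖(B_a ⊗ I)ⁿ y‖²`. For `N ≥ 1` it decreases
in `N` and is constant once `N > j`, where it equals the `j`-th coefficient of `(1 - t) ^ a (1 - t)
^ (-a) = 1`. -/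
theorem sum_range_cesaroNumber_mul_ite_nonneg (ha₀ : 0 < a) (ha₁ : a < 1) (N j : ℕ) :
    0 ≤ ∑ n ∈ Finset.range N,
      cesaroNumber (-a) n * (if n ≤ j then cesaroNumber a (j - n) else 0) := by
  obtain _ | N := N
  · simp
  set g : ℕ → ℝ := fun n => cesaroNumber (-a) n * (if n ≤ j then cesaroNumber a (j - n) else 0)
  have hg : ∀ n, g (n + 1) ≤ 0 := fun n => by
    refine mul_nonpos_of_nonpos_of_nonneg (cesaroNumber_neg_succ_nonpos ha₀ ha₁ n) ?_
    split_ifs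
    · exact (cesaroNumber_pos ha₀ _).le
    · exact le_rfl
  have hanti : Antitone fun N => ∑ n ∈ Finset.range (N + 1), g n :=
    antitone_nat_of_succ_le fun N => by
      rw [Finset.sum_range_succ _ (N + 1)]
      linarith [hg N]
  have hj : 0 ≤ ∑ n ∈ Finset.range (j + 1), g n := by
    have h := sum_antidiagonal_cesaroNumber a j
    rw [Finset.Nat.sum_antidiagonal_eq_sum_range_succ
      (fun p q => cesaroNumber (-a) p * cesaroNumber a q)] at h
    have h2 : ∑ n ∈ Finset.range (j + 1), g n =
        ∑ n ∈ Finset.range (j + 1), cesaroNumber (-a) n * cesaroNumber a (j - n) :=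
      Finset.sum_congr rfl fun n hn => by
        have : n ≤ j := Nat.lt_succ_iff.1 (Finset.mem_range.1 hn)
        simp [g, this]
    rw [h2, h]
    split_ifs <;> norm_num
  rcases le_total N j with hN | hN
  · exact hj.trans (hanti hN)
  · refine hj.trans_eq (Finset.sum_subset (Finset.range_mono (by lia)) fun n _ hn => ?_)
    have : ¬ n ≤ j := fun h => hn (Finset.mem_range.2 (by lia))
    simp [g, this]

variable {E : Type*} [NormedAddCommGroup E] [InnerProductSpace ℂ E] [CompleteSpace E]

theorem sum_norm_tensorId_backwardShift_pow_nonneg (ha₀ : 0 < a) (ha₁ : a < 1)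
    (y : HilbertTensor (PowerSeriesSpace a ha₀) E) (N : ℕ) :
    0 ≤ ∑ n ∈ Finset.range N,
      cesaroNumber (-a) n * ‖(tensorId (backwardShift a ha₀) E ^ n) y‖ ^ 2 := by
  have h : ∀ n, HasSum (fun j => (if n ≤ j then cesaroNumber a (j - n) else 0) *
      ‖WeightedSpace.tensorCoeff j y‖ ^ 2) (‖(tensorId (backwardShift a ha₀) E ^ n) y‖ ^ 2) := by
    intro n
    have h1 := WeightedSpace.hasSum_tensorCoeff ((tensorId (backwardShift a ha₀) E ^ n) y)
    simp only [backwardShift, WeightedSpace.tensorCoeff_tensorId_backwardShift_pow] at h1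
    have h2 := (hasSum_nat_add_iff (f := fun j => (if n ≤ j then cesaroNumber a (j - n) else 0) *
      ‖WeightedSpace.tensorCoeff j y‖ ^ 2) n).1
      (by simpa only [Nat.le_add_left, if_true, Nat.add_sub_cancel] using h1)
    rw [Finset.sum_eq_zero, add_zero] at h2
    · exact h2
    · intro i hi
      rw [if_neg (not_le.2 (Finset.mem_range.1 hi)), zero_mul]
  have hs := hasSum_sum (s := Finset.range N) fun n _ => (h n).mul_left (cesaroNumber (-a) n)
  refine hs.nonneg fun j => ?_
  simp only [← mul_assoc, ← Finset.sum_mul]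
  exact mul_nonneg (sum_range_cesaroNumber_mul_ite_nonneg ha₀ ha₁ N j) (by positivity)

/-- Serves the isometric summand, where `‖Sⁿ z‖` does not depend on `n`. -/
theorem sum_range_cesaroNumber_neg_nonneg (ha₁ : a < 1) (N : ℕ) :
    0 ≤ ∑ n ∈ Finset.range N, cesaroNumber (-a) n := by
  obtain _ | N := N
  · simp
  · rw [sum_range_succ_cesaroNumber]
    exact (cesaroNumber_pos (by linarith) N).le

theorem directSum_pow_apply {X Y : Type*} [NormedAddCommGroup X] [InnerProductSpace ℂ X]
    [NormedAddCommGroup Y] [InnerProductSpace ℂ Y] (A : X →L[ℂ] X) (S : Y →L[ℂ] Y) (n : ℕ)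
    (w : WithLp 2 (X × Y)) :
    (directSum A S ^ n) w = WithLp.toLp 2 ((A ^ n) w.fst, (S ^ n) w.snd) := by
  induction n with
  | zero => rfl
  | succ n ih =>
    rw [pow_succ', mul_apply_eq_comp, ih, pow_succ', pow_succ']
    rfl

theorem LinearIsometry.norm_toContinuousLinearMap_pow {K : Type*} [NormedAddCommGroup K]
    [InnerProductSpace ℂ K] (S : K →ₗᵢ[ℂ] K) (n : ℕ) (z : K) :
    ‖(S.toContinuousLinearMap ^ n) z‖ = ‖z‖ := by
  induction n with
  | zero => rfl
  | succ n ih =>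
    rw [pow_succ', mul_apply_eq_comp, ← ih]
    exact S.norm_map _

/-- The convergence criterion sees `T` only through the numbers `‖Tⁿ x‖`, so this is all that has to
be transferred from the model. -/
theorem IsUnitarilyEquivalentToPart.exists_norm_pow_eq {H X : Type*} [NormedAddCommGroup H]
    [InnerProductSpace ℂ H] [NormedAddCommGroup X] [InnerProductSpace ℂ X] {T : H →L[ℂ] H}
    {A : X →L[ℂ] X} (h : IsUnitarilyEquivalentToPart T A) (x : H) :
    ∃ w : X, ∀ n, ‖(T ^ n) x‖ = ‖(A ^ n) w‖ := by
  obtain ⟨M, hM, U, -, hU⟩ := h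
  have h1 : ∀ n, (U ((T ^ n) x) : X) = (A ^ n) (U x) := by
    intro n
    induction n with
    | zero => rfl
    | succ n ih =>
      rw [pow_succ', mul_apply_eq_comp, hU, pow_succ', mul_apply_eq_comp, ← ih]
      rfl
  exact ⟨U x, fun n => by rw [← h1, Submodule.norm_coe, U.norm_map]⟩

end ModelToContraction

theorem HasModel.isAContraction {H : Type u} [NormedAddCommGroup H] [InnerProductSpace ℂ H]
    [CompleteSpace H] {a : ℝ} {ha₀ : 0 < a} (ha₁ : a < 1) {T : H →L[ℂ] H} {E : Type u}
    [NormedAddCommGroup E] [InnerProductSpace ℂ E] [CompleteSpace E] (h : HasModel a ha₀ T E) :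
    IsAContraction a T := by
  obtain ⟨K, _, _, _, S, hT⟩ := h
  refine exists_hasHereditarySum_of_sum_nonneg (cesaroNumber_zero _)
    (cesaroNumber_neg_succ_nonpos ha₀ ha₁) T fun N x => ?_
  obtain ⟨w, hw⟩ := hT.exists_norm_pow_eq x
  have h1 : ∀ n, ‖(T ^ n) x‖ ^ 2 =
      ‖(tensorId (backwardShift a ha₀) E ^ n) w.fst‖ ^ 2 + ‖w.snd‖ ^ 2 := fun n => by
    rw [hw, directSum_pow_apply, WithLp.prod_norm_sq_eq_of_L2,
      ← S.norm_toContinuousLinearMap_pow n w.snd]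
    rfl
  simp only [h1, mul_add, Finset.sum_add_distrib, ← Finset.sum_mul]
  exact add_nonneg (sum_norm_tensorId_backwardShift_pow_nonneg ha₀ ha₁ _ N)
    (mul_nonneg (sum_range_cesaroNumber_neg_nonneg ha₁ N) (by positivity))

/-! ### The model of an `a`-contraction -/

section ContractionToModel

variable {H : Type u} [NormedAddCommGroup H] [InnerProductSpace ℂ H] [CompleteSpace H]

/-- The hypothesis makes `L x ↦ L (T x)` well defined and isometric on the range of `L`; it extends
by density. -/
theorem exists_isometry_closure_range {L T : H →L[ℂ] H} (h : ∀ x, ‖L (T x)‖ = ‖L x‖) :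
    ∃ S : L.range.topologicalClosure →ₗᵢ[ℂ] L.range.topologicalClosure,
      ∀ x, ((S ⟨L x, subset_closure ⟨x, rfl⟩⟩ : L.range.topologicalClosure) : H) = L (T x) := by
  set e : H →ₗ[ℂ] L.range.topologicalClosure :=
    L.toLinearMap.codRestrict _ fun x => subset_closure ⟨x, rfl⟩
  have hcoe : ∀ x, (e x : H) = L x := fun x => rfl
  have hnorm : ∀ x, ‖e x‖ = ‖L x‖ := fun x => rfl
  have hdense : DenseRange e := by
    intro y
    rw [closure_subtype]
    have h2 : (Subtype.val '' Set.range e) = (L.range : Set H) := by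
      rw [← Set.range_comp]
      rfl
    rw [h2]
    exact y.2
  set F : L.range.topologicalClosure →L[ℂ] L.range.topologicalClosure :=
    (e ∘ₗ T.toLinearMap).extendOfNorm e
  have hF : ∀ x, F (e x) = e (T x) := LinearMap.extendOfNorm_eq hdense
    ⟨1, fun x => by rw [one_mul]; exact (h x).le⟩
  refine ⟨⟨F.toLinearMap, fun y => ?_⟩, fun x => congrArg Subtype.val (hF x)⟩
  change ‖F y‖ = ‖y‖
  refine hdense.induction_on y (isClosed_eq (by fun_prop) (by fun_prop)) fun x => ?_
  rw [hF]
  exact h x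

/-- The map `x ↦ (V x, L x)` is an isometry, and its range is closed because `H` is complete. -/
theorem isUnitarilyEquivalentToPart_directSum {X K : Type*} [NormedAddCommGroup X]
    [InnerProductSpace ℂ X] [NormedAddCommGroup K] [InnerProductSpace ℂ K]
    {T : H →L[ℂ] H} {A : X →L[ℂ] X} {S : K →L[ℂ] K} (V : H →ₗ[ℂ] X) (L : H →ₗ[ℂ] K)
    (hnorm : ∀ x, ‖V x‖ ^ 2 + ‖L x‖ ^ 2 = ‖x‖ ^ 2) (hV : ∀ x, V (T x) = A (V x))
    (hL : ∀ x, L (T x) = S (L x)) : IsUnitarilyEquivalentToPart T (directSum A S) := by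
  let J : H →ₗᵢ[ℂ] WithLp 2 (X × K) :=
    { toLinearMap := (WithLp.linearEquiv 2 ℂ (X × K)).symm.toLinearMap ∘ₗ V.prod L
      norm_map' := fun x => by
        rw [← sq_eq_sq₀ (norm_nonneg _) (norm_nonneg _), WithLp.prod_norm_sq_eq_of_L2, ← hnorm x]
        rfl }
  have hJ : ∀ x, J (T x) = directSum A S (J x) := fun x => by
    change WithLp.toLp 2 (V (T x), L (T x)) = WithLp.toLp 2 (A (V x), S (L x))
    rw [hV, hL]
  refine ⟨LinearMap.range J.toLinearMap, ?_, J.equivRange, ?_, fun x => ?_⟩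
  · rintro _ ⟨x, rfl⟩
    exact ⟨T x, hJ x⟩
  · exact J.isometry.isClosedEmbedding.isClosed_range
  · exact Subtype.ext (hJ x)

variable {a : ℝ} {T : H →L[ℂ] H}

theorem IsAContraction.hasSum_norm_defectOperator (ha₀ : 0 < a) (ha₁ : a < 1)
    (h : IsAContraction a T) (x : H) :
    HasSum (fun n => cesaroNumber (-a) n * ‖(T ^ n) x‖ ^ 2) (‖defectOperator a T x‖ ^ 2) := by
  obtain ⟨A, hA, hpos⟩ := h
  rw [defectOperator, hA.hereditary_eq, hpos.norm_sqrt_apply_sq]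
  exact hA.hasSum (cesaroNumber_neg_succ_nonpos ha₀ ha₁) x

/-- Identifies `d_m` for `u_n = ‖Tⁿ x‖²`, which supplies both the summability and the sign needed
for the inversion. -/
theorem IsAContraction.hasSum_norm_defectOperator_pow (ha₀ : 0 < a) (ha₁ : a < 1)
    (h : IsAContraction a T) (x : H) (m : ℕ) :
    HasSum (fun n => cesaroNumber (-a) n * ‖(T ^ (n + m)) x‖ ^ 2)
      (‖defectOperator a T ((T ^ m) x)‖ ^ 2) := by
  simpa only [pow_add, mul_apply_eq_comp] using
    h.hasSum_norm_defectOperator ha₀ ha₁ ((T ^ m) x)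

theorem IsAContraction.summable_norm_defectOperator (ha₀ : 0 < a) (ha₁ : a < 1)
    (h : IsAContraction a T) (x : H) :
    (Summable fun m => cesaroNumber a m * ‖defectOperator a T ((T ^ m) x)‖ ^ 2) ∧
      ∑' m, cesaroNumber a m * ‖defectOperator a T ((T ^ m) x)‖ ^ 2 ≤ ‖x‖ ^ 2 := by
  have hd := h.hasSum_norm_defectOperator_pow ha₀ ha₁ x
  have h1 := summable_and_tsum_le (u := fun n => ‖(T ^ n) x‖ ^ 2) ha₀ ha₁
    (fun n => by positivity) (fun m => (hd m).summable)
    (fun m => by rw [(hd m).tsum_eq]; positivity)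
  simpa only [(hd _).tsum_eq, pow_zero, one_apply_eq_self] using h1

theorem IsAContraction.norm_sq_sub_tsum_apply (ha₀ : 0 < a) (ha₁ : a < 1)
    (h : IsAContraction a T) (x : H) :
    ‖T x‖ ^ 2 - ∑' m, cesaroNumber a m * ‖defectOperator a T ((T ^ m) (T x))‖ ^ 2 =
      ‖x‖ ^ 2 - ∑' m, cesaroNumber a m * ‖defectOperator a T ((T ^ m) x)‖ ^ 2 := by
  have hd := h.hasSum_norm_defectOperator_pow ha₀ ha₁ x
  have h1 := sub_tsum_shift_eq (u := fun n => ‖(T ^ n) x‖ ^ 2) ha₀ ha₁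
    (fun n => by positivity) (fun m => (hd m).summable)
    (fun m => by rw [(hd m).tsum_eq]; positivity)
  simp only [(hd _).tsum_eq, pow_zero, pow_one, one_apply_eq_self] at h1
  simpa only [pow_succ, mul_apply_eq_comp] using h1

/-- The map `x ↦ (D Tⁿ x)` of an `a`-contraction into `𝓗_a ⊗ 𝔇`. -/
theorem IsAContraction.exists_defectMap (ha₀ : 0 < a) (ha₁ : a < 1) (h : IsAContraction a T) :
    ∃ V : H →ₗ[ℂ] HilbertTensor (PowerSeriesSpace a ha₀) (defectSpace a T),
      ∀ n x, ((WeightedSpace.tensorCoeff n (V x) : defectSpace a T) : H) =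
        defectOperator a T ((T ^ n) x) := by
  let c : ℕ → H →ₗ[ℂ] defectSpace a T := fun n =>
    (defectOperator a T * T ^ n).toLinearMap.codRestrict _ fun x => subset_closure ⟨_, rfl⟩
  have hc : ∀ n x, ‖c n x‖ = ‖defectOperator a T ((T ^ n) x)‖ := fun n x => rfl
  -- The weight `√k_n` passes to `ℓ²` coordinates; it cancels in `tensorCoeff`.
  let r : ℕ → ℂ := fun n => ((Real.sqrt (cesaroNumber a n) : ℝ) : ℂ)
  have hmem : ∀ x, Memℓp (fun n => r n • c n x) 2 := fun x => by
    rw [memℓp_gen_iff (by norm_num)]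
    refine (h.summable_norm_defectOperator ha₀ ha₁ x).1.congr fun n => ?_
    rw [← hc, norm_smul, Complex.norm_real, Real.norm_eq_abs, ENNReal.toReal_ofNat,
      Real.rpow_ofNat, mul_pow, sq_abs, Real.sq_sqrt (cesaroNumber_pos ha₀ n).le]
  let G : H →ₗ[ℂ] lp (fun _ : ℕ => defectSpace a T) 2 :=
    { toFun := fun x => ⟨fun n => r n • c n x, hmem x⟩
      map_add' := fun x y => by
        ext n : 2
        exact (by rw [map_add, smul_add] : r n • c n (x + y) = r n • c n x + r n • c n y)
      map_smul' := fun z x => by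
        ext n : 2
        exact (by rw [map_smul, smul_comm] : r n • c n (z • x) = z • (r n • c n x)) }
  refine ⟨(WeightedSpace.tensorEquivSeq _ (cesaroNumber_pos ha₀)
    (defectSpace a T)).symm.toLinearEquiv.toLinearMap ∘ₗ G, fun n x => ?_⟩
  have h1 := WeightedSpace.tensorEquivSeq_symm_coeff (hk := cesaroNumber_pos ha₀) (G x) n
  have h2 : (((Real.sqrt (cesaroNumber a n))⁻¹ : ℝ) : ℂ) • G x n = c n x := by
    change _ • r n • c n x = _
    have h0 : ((Real.sqrt (cesaroNumber a n) : ℝ) : ℂ) ≠ 0 := by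
      exact_mod_cast (Real.sqrt_pos.2 (cesaroNumber_pos ha₀ n)).ne'
    rw [smul_smul, Complex.ofReal_inv, inv_mul_cancel₀ h0, one_smul]
  rw [h2] at h1
  exact congrArg Subtype.val h1

theorem IsAContraction.hasModel (ha₀ : 0 < a) (ha₁ : a < 1) (h : IsAContraction a T) :
    HasModel a ha₀ T (defectSpace a T) := by
  obtain ⟨V₀, hV₀⟩ := h.exists_defectMap ha₀ ha₁
  have hnorm₀ : ∀ x, ‖V₀ x‖ ^ 2 =
      ∑' m, cesaroNumber a m * ‖defectOperator a T ((T ^ m) x)‖ ^ 2 := fun x => by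
    rw [← (WeightedSpace.hasSum_tensorCoeff (V₀ x)).tsum_eq]
    exact tsum_congr fun n => by rw [← hV₀]; rfl
  have hle : ∀ x, ‖V₀ x‖ ^ 2 ≤ ‖x‖ ^ 2 := fun x => by
    rw [hnorm₀]
    exact (h.summable_norm_defectOperator ha₀ ha₁ x).2
  let V : H →L[ℂ] HilbertTensor (PowerSeriesSpace a ha₀) (defectSpace a T) :=
    V₀.mkContinuous 1 fun x => by
      rw [one_mul]
      exact le_of_sq_le_sq (hle x) (norm_nonneg x)
  have hV : ∀ x, V x = V₀ x := fun x => rfl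
  -- The quadratic form of `1 - V*V` is the limit of the inversion remainders, hence invariant under
  -- `T`.
  let Q : H →L[ℂ] H := 1 - ContinuousLinearMap.adjoint V ∘L V
  have hQ : ∀ x, (inner ℂ (Q x) x).re = ‖x‖ ^ 2 - ‖V₀ x‖ ^ 2 := fun x => by
    change (inner ℂ (x - ContinuousLinearMap.adjoint V (V x)) x).re = _
    rw [inner_sub_left, ContinuousLinearMap.adjoint_inner_left, Complex.sub_re, ← hV,
      ← inner_self_eq_norm_sq (𝕜 := ℂ), ← inner_self_eq_norm_sq (𝕜 := ℂ)]
    rfl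
  have hQpos : Q.IsPositive := by
    refine ContinuousLinearMap.isPositive_def'.2 ⟨?_, fun x => ?_⟩
    · exact (IsSelfAdjoint.one _).sub
        (ContinuousLinearMap.isPositive_adjoint_comp_self V).isSelfAdjoint
    · change 0 ≤ (inner ℂ (Q x) x).re
      rw [hQ]
      linarith [hle x]
  have hL : ∀ x, ‖CFC.sqrt Q x‖ ^ 2 = ‖x‖ ^ 2 - ‖V₀ x‖ ^ 2 := fun x => by
    rw [hQpos.norm_sqrt_apply_sq, hQ]
  have hLT : ∀ x, ‖CFC.sqrt Q (T x)‖ = ‖CFC.sqrt Q x‖ := fun x => by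
    rw [← sq_eq_sq₀ (norm_nonneg _) (norm_nonneg _), hL, hL, hnorm₀, hnorm₀]
    exact h.norm_sq_sub_tsum_apply ha₀ ha₁ x
  obtain ⟨S, hS⟩ := exists_isometry_closure_range hLT
  refine ⟨(CFC.sqrt Q).range.topologicalClosure, inferInstance, inferInstance,
    (CFC.sqrt Q).range.isClosed_topologicalClosure.completeSpace_coe, S, ?_⟩
  refine isUnitarilyEquivalentToPart_directSum V₀
    ((CFC.sqrt Q).toLinearMap.codRestrict _ fun x => subset_closure ⟨x, rfl⟩)
    (fun x => ?_) (fun x => ?_) (fun x => ?_)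
  · have := hL x
    change ‖V₀ x‖ ^ 2 + ‖CFC.sqrt Q x‖ ^ 2 = _
    linarith
  · refine WeightedSpace.tensor_ext fun n => ?_
    rw [backwardShift, WeightedSpace.tensorCoeff_tensorId_backwardShift]
    refine Subtype.ext ?_
    rw [hV₀, hV₀, pow_succ, mul_apply_eq_comp]
  · exact Subtype.ext (hS x).symm

end ContractionToModel

theorem theorem1p3 {H : Type u} [NormedAddCommGroup H] [InnerProductSpace ℂ H]
    [CompleteSpace H] [TopologicalSpace.SeparableSpace H]
    (a : ℝ) (ha₀ : 0 < a) (ha₁ : a < 1) (T : H →L[ℂ] H) :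
    (IsAContraction a T ↔
      ∃ (E : Type u) (_ : NormedAddCommGroup E) (_ : InnerProductSpace ℂ E) (_ : CompleteSpace E)
        (_ : TopologicalSpace.SeparableSpace E), HasModel a ha₀ T E) ∧
    ((∃ (E : Type u) (_ : NormedAddCommGroup E) (_ : InnerProductSpace ℂ E) (_ : CompleteSpace E)
        (_ : TopologicalSpace.SeparableSpace E), HasModel a ha₀ T E) →
      HasModel a ha₀ T (defectSpace a T)) := by
  have hback : (∃ (E : Type u) (_ : NormedAddCommGroup E) (_ : InnerProductSpace ℂ E)
      (_ : CompleteSpace E) (_ : TopologicalSpace.SeparableSpace E), HasModel a ha₀ T E) →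
      IsAContraction a T := by
    rintro ⟨E, _, _, _, _, h⟩
    exact h.isAContraction ha₁
  refine ⟨⟨fun h => ⟨defectSpace a T, inferInstance, inferInstance, ?_, ?_,
    h.hasModel ha₀ ha₁⟩, hback⟩, fun h => (hback h).hasModel ha₀ ha₁⟩
  · exact (defectOperator a T).range.isClosed_topologicalClosure.completeSpace_coe
  -- Second countability, unlike separability, passes to arbitrary subspaces.
  · have := UniformSpace.secondCountable_of_separable H
    infer_instance
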